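/- For a positive integer $k$ let $P_k(N)=\prod_{0\le i,j\le k-1}\left(1+\frac{N}{i+j+1}\right)$, the polynomial in $N$ of degree $k^2$ whose value at a positive integer $N$ is, by Keating and Snaith, the $2k$-th absolute moment of the characteristic polynomial of a Haar-distributed $N\times N$ unitary matrix at a point of the unit circle. Define its coefficients $c_r(k)$, $0\le r\le k^2$, by $P_k(N)=\sum_{r=0}^{k^2}c_r(k)N^{k^2-r}$, and call $c_r(k)$ maximal if $c_s(k)\le c_r(k)$ for all $0\le s\le k^2$. Let $$\mu=\mu(k)=\sum_{j=1}^{k}\frac{j}{j+1}+\sum_{j=k+1}^{2k}\frac{2k-j}{j+1}.$$ Then $\mu=k\log 4-\log(k/2)-\frac12-\gamma+O(1/k)$ as $k\to\infty$, where $\gamma$ is the Euler constant. Moreover, there exists $\rho>0$ such that, for all sufficiently large $k$, a maximal $c_r(k)$ occurs for some $$r\in\left[k^2-\mu-\frac{\rho(\log k)^2}{k},\ k^2-\mu+1+\frac{\rho(\log k)^2}{k}\right],$$ and no maximal $c_r(k)$ occurs for an $r$ outside of that interval. -/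

import Mathlib

noncomputable section

namespace KeatingSnaith

/-- The Keating–Snaith moment polynomial of degree `k ^ 2`,
`P_k(N) = ∏_{0 ≤ i, j ≤ k - 1} (1 + N / (i + j + 1))`; its value at a positive integer `N` is the
`2k`-th absolute moment of the characteristic polynomial of an `N × N` Haar unitary matrix. -/
def momentPoly (k : ℕ) : Polynomial ℝ :=
  ∏ i ∈ Finset.range k, ∏ j ∈ Finset.range k,
    (1 + Polynomial.C (1 / ((i : ℝ) + (j : ℝ) + 1)) * Polynomial.X)

/-- `c_r(k)`, for `0 ≤ r ≤ k ^ 2`: the coefficient of `N ^ (k ^ 2 - r)` in `P_k(N)`. -/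
def momentCoeff (r k : ℕ) : ℝ :=
  (momentPoly k).coeff (k ^ 2 - r)

/-- `c_r(k)` is a maximal coefficient: `0 ≤ r ≤ k ^ 2`, and `c_s(k) ≤ c_r(k)` for all
`0 ≤ s ≤ k ^ 2`. -/
def IsMaximalIndex (k r : ℕ) : Prop :=
  r ≤ k ^ 2 ∧ ∀ s : ℕ, s ≤ k ^ 2 → momentCoeff s k ≤ momentCoeff r k

/-- `μ = ∑_{j=1}^{k} j / (j + 1) + ∑_{j=k+1}^{2k} (2k - j) / (j + 1)`. -/
def mu (k : ℕ) : ℝ :=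
  ∑ j ∈ Finset.Icc 1 k, (j : ℝ) / ((j : ℝ) + 1) +
    ∑ j ∈ Finset.Icc (k + 1) (2 * k), (2 * (k : ℝ) - (j : ℝ)) / ((j : ℝ) + 1)

end KeatingSnaith

end

/-! Normalising each factor of $P_k$ by its value at $N=1$ gives $1-p+pN$ with $p=1/(i+j+2)$. So
$P_k$ is a positive multiple of the generating function of a sum of $k^2$ independent Bernoulli
variables of mean $\mu$, and maximal $c_r$ correspond to modes $M=k^2-r$.

With $q$ the law of the sum and $q^{(i)}$ that of the sum without variable $i$, `stein_identity`
says $(m+1)q_{m+1}-\mu q_m=\sum_i p_i^2\,(q^{(i)}_m-q^{(i)}_{m-1})$. Let $\sigma=\sum p_i^2$, which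
is $O(\log k)$. Bounding the right side by $2\sigma\max q$ places $M$ within $O(\sigma+1)$ of $\mu$.
The same bound for $q^{(i)}$ then makes its increments near $M$ at most $O((\sigma+1)/\mu)\max q$.
Fed back into the identity, this reduces the error to $O(\sigma(\sigma+1)/\mu)=O((\log k)^2/k)$
(`mode_mem_Icc`). -/

open Polynomial in
/-- The probability generating function of a sum of independent Bernoulli variables of parameters
`p i`, `i ∈ s`. -/
noncomputable def bernoulliSumPGF {ι : Type*} (p : ι → ℝ) (s : Finset ι) : ℝ[X] :=
  ∏ i ∈ s, (C (1 - p i) + C (p i) * X)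

/-! ### Stein–Chen estimates and the mode of a Bernoulli sum. -/

namespace bernoulliSumPGF

open Polynomial

variable {ι : Type*} {p : ι → ℝ} {s : Finset ι}

theorem coeff_nonneg (h0 : ∀ i, 0 ≤ p i) (h1 : ∀ i, p i ≤ 1 / 2) (s : Finset ι) (m : ℕ) :
    0 ≤ (bernoulliSumPGF p s).coeff m := by
  classical
  unfold bernoulliSumPGF
  induction s using Finset.induction_on generalizing m with
  | empty =>
    rw [Finset.prod_empty, coeff_one]
    split_ifs <;> norm_num
  | insert a s ha ih =>
    rw [Finset.prod_insert ha, add_mul, mul_assoc, coeff_add, coeff_C_mul, coeff_C_mul]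
    have h2 : 0 ≤ 1 - p a := by linarith [h1 a]
    refine add_nonneg (mul_nonneg h2 (ih m)) (mul_nonneg (h0 a) ?_)
    cases m with
    | zero => simp
    | succ m => rw [coeff_X_mul]; exact ih m

theorem coeff_zero_pos (h1 : ∀ i, p i ≤ 1 / 2) (s : Finset ι) :
    0 < (bernoulliSumPGF p s).coeff 0 := by
  rw [bernoulliSumPGF, coeff_zero_eq_eval_zero, eval_prod]
  refine Finset.prod_pos fun i _ => ?_
  simp only [eval_add, eval_C, eval_mul, eval_X, mul_zero, add_zero]
  linarith [h1 i]

variable [DecidableEq ι]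

theorem eq_mul_erase {i : ι} (hi : i ∈ s) :
    bernoulliSumPGF p s = (C (1 - p i) + C (p i) * X) * bernoulliSumPGF p (s.erase i) :=
  (Finset.mul_prod_erase s (fun i => C (1 - p i) + C (p i) * X) hi).symm

theorem coeff_zero_eq {i : ι} (hi : i ∈ s) :
    (bernoulliSumPGF p s).coeff 0 = (1 - p i) * (bernoulliSumPGF p (s.erase i)).coeff 0 := by
  rw [eq_mul_erase hi]
  simp [mul_coeff_zero]

theorem coeff_succ_eq {i : ι} (hi : i ∈ s) (m : ℕ) :
    (bernoulliSumPGF p s).coeff (m + 1) =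
      (1 - p i) * (bernoulliSumPGF p (s.erase i)).coeff (m + 1) +
        p i * (bernoulliSumPGF p (s.erase i)).coeff m := by
  rw [eq_mul_erase hi, add_mul, mul_assoc, coeff_add, coeff_C_mul, coeff_C_mul, coeff_X_mul]

/-- The erased variable vanishes with probability at least 1/2. -/
theorem coeff_erase_le (h0 : ∀ i, 0 ≤ p i) (h1 : ∀ i, p i ≤ 1 / 2) {Q : ℝ}
    (hQ : ∀ m, (bernoulliSumPGF p s).coeff m ≤ Q) {i : ι} (hi : i ∈ s) (m : ℕ) :
    (bernoulliSumPGF p (s.erase i)).coeff m ≤ 2 * Q := by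
  have key : (1 - p i) * (bernoulliSumPGF p (s.erase i)).coeff m ≤
      (bernoulliSumPGF p s).coeff m := by
    cases m with
    | zero => rw [coeff_zero_eq hi]
    | succ m =>
      rw [coeff_succ_eq hi]
      linarith [mul_nonneg (h0 i) (coeff_nonneg h0 h1 (s.erase i) m)]
  nlinarith [hQ m, coeff_nonneg h0 h1 (s.erase i) m, h1 i]

theorem succ_mul_coeff_succ (m : ℕ) :
    ((m : ℝ) + 1) * (bernoulliSumPGF p s).coeff (m + 1) =
      ∑ i ∈ s, p i * (bernoulliSumPGF p (s.erase i)).coeff m := by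
  have h := congrArg (fun f : ℝ[X] => f.coeff m)
    (derivative_prod_finset (s := s) (f := fun i => C (1 - p i) + C (p i) * X))
  simp only [coeff_derivative, finsetSum_coeff, derivative_add, derivative_C, zero_add,
    derivative_C_mul, derivative_X, mul_one, coeff_mul_C] at h
  rw [mul_comm, bernoulliSumPGF, h]
  exact Finset.sum_congr rfl fun i _ => mul_comm _ _

/-- The Stein–Chen identity: the failure of the Poisson recursion. -/
theorem stein_identity (m : ℕ) :
    ((m : ℝ) + 2) * (bernoulliSumPGF p s).coeff (m + 2) -
        (∑ i ∈ s, p i) * (bernoulliSumPGF p s).coeff (m + 1) =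
      ∑ i ∈ s, p i ^ 2 * ((bernoulliSumPGF p (s.erase i)).coeff (m + 1) -
        (bernoulliSumPGF p (s.erase i)).coeff m) := by
  have h := succ_mul_coeff_succ (p := p) (s := s) (m + 1)
  push_cast at h
  -- Restoring variable `i` in the coefficient at `m + 1` cancels the terms linear in `p i`.
  rw [show (m : ℝ) + 2 = m + 1 + 1 by ring, h, Finset.sum_mul, ← Finset.sum_sub_distrib]
  refine Finset.sum_congr rfl fun i hi => ?_
  rw [coeff_succ_eq hi m]
  ring

theorem abs_stein_le {D : ℝ} (m : ℕ)
    (hD : ∀ i ∈ s, |(bernoulliSumPGF p (s.erase i)).coeff (m + 1) -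
        (bernoulliSumPGF p (s.erase i)).coeff m| ≤ D) :
    |((m : ℝ) + 2) * (bernoulliSumPGF p s).coeff (m + 2) -
        (∑ i ∈ s, p i) * (bernoulliSumPGF p s).coeff (m + 1)| ≤ (∑ i ∈ s, p i ^ 2) * D := by
  rw [stein_identity, Finset.sum_mul]
  refine (Finset.abs_sum_le_sum_abs _ _).trans (Finset.sum_le_sum fun i hi => ?_)
  rw [abs_mul, abs_of_nonneg (sq_nonneg _)]
  exact mul_le_mul_of_nonneg_left (hD i hi) (sq_nonneg _)

theorem abs_stein_le_of_le (h0 : ∀ i, 0 ≤ p i) (h1 : ∀ i, p i ≤ 1 / 2) {Q : ℝ}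
    (hQ : ∀ m, (bernoulliSumPGF p s).coeff m ≤ Q) (m : ℕ) :
    |((m : ℝ) + 2) * (bernoulliSumPGF p s).coeff (m + 2) -
        (∑ i ∈ s, p i) * (bernoulliSumPGF p s).coeff (m + 1)| ≤
      (∑ i ∈ s, p i ^ 2) * (2 * Q) := by
  refine abs_stein_le m fun i hi => ?_
  have a1 := coeff_erase_le h0 h1 hQ hi m
  have a2 := coeff_erase_le h0 h1 hQ hi (m + 1)
  have b1 := coeff_nonneg h0 h1 (s.erase i) m
  have b2 := coeff_nonneg h0 h1 (s.erase i) (m + 1)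
  rw [abs_le]
  constructor <;> linarith

/-- The erased sum nearly satisfies the Poisson recursion, whose consecutive ratio is close to 1
near the mean. Erasing twice costs the factor 4. -/
theorem mul_abs_coeff_erase_sub_le (h0 : ∀ i, 0 ≤ p i) (h1 : ∀ i, p i ≤ 1 / 2) {Q : ℝ}
    (hQ : ∀ m, (bernoulliSumPGF p s).coeff m ≤ Q) {i : ι} (hi : i ∈ s) (m : ℕ) :
    ((m : ℝ) + 2) * |(bernoulliSumPGF p (s.erase i)).coeff (m + 2) -
        (bernoulliSumPGF p (s.erase i)).coeff (m + 1)| ≤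
      (2 * (|∑ i ∈ s, p i - (m + 2)| + 1) + 4 * ∑ i ∈ s, p i ^ 2) * Q := by
  have hQ0 : 0 ≤ Q := (coeff_nonneg h0 h1 s 0).trans (hQ 0)
  have hst := abs_stein_le_of_le (s := s.erase i) h0 h1 (coeff_erase_le h0 h1 hQ hi) m
  have hs1 := Finset.add_sum_erase s p hi
  have hs2 := Finset.add_sum_erase s (fun i => p i ^ 2) hi
  have hc0 := coeff_nonneg h0 h1 (s.erase i) (m + 1)
  have hc1 := coeff_erase_le h0 h1 hQ hi (m + 1)
  have hμ : |(∑ j ∈ s.erase i, p j) - (m + 2)| ≤ |∑ i ∈ s, p i - (m + 2)| + 1 := by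
    rw [← hs1]
    have := abs_sub_abs_le_abs_sub ((∑ j ∈ s.erase i, p j) - ((m : ℝ) + 2))
      (p i + (∑ j ∈ s.erase i, p j) - (m + 2))
    rw [show ((∑ j ∈ s.erase i, p j) - ((m : ℝ) + 2)) -
      (p i + (∑ j ∈ s.erase i, p j) - (m + 2)) = -p i by ring, abs_neg, abs_of_nonneg (h0 i)] at this
    linarith [h1 i]
  have hm : (0 : ℝ) ≤ (m : ℝ) + 2 := by positivity
  set x := (bernoulliSumPGF p (s.erase i)).coeff (m + 2)
  set y := (bernoulliSumPGF p (s.erase i)).coeff (m + 1)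
  set μ' := ∑ j ∈ s.erase i, p j
  calc ((m : ℝ) + 2) * |x - y| = |(((m : ℝ) + 2) * x - μ' * y) + (μ' - (m + 2)) * y| := by
        rw [← abs_of_nonneg hm, ← abs_mul, abs_of_nonneg hm]; congr 1; ring
    _ ≤ |((m : ℝ) + 2) * x - μ' * y| + |μ' - (m + 2)| * |y| := by
        rw [← abs_mul]; exact abs_add_le _ _
    _ ≤ (∑ j ∈ s, p j ^ 2) * (2 * (2 * Q)) + (|∑ i ∈ s, p i - (m + 2)| + 1) * (2 * Q) := by
        rw [abs_of_nonneg hc0]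
        refine add_le_add (hst.trans ?_) (mul_le_mul hμ hc1 hc0 (by positivity))
        refine mul_le_mul_of_nonneg_right ?_ (by positivity)
        linarith [sq_nonneg (p i)]
    _ = _ := by ring

/-- The mode `M` of a sum of independent Bernoulli variables of mean `μ` lies in `[μ - 1, μ]`, up
to an error controlled by the sum of the squares of the parameters. -/
theorem mode_mem_Icc (h0 : ∀ i, 0 ≤ p i) (h1 : ∀ i, p i ≤ 1 / 2) {M : ℕ}
    (hM : ∀ m, (bernoulliSumPGF p s).coeff m ≤ (bernoulliSumPGF p s).coeff M) {μ σ : ℝ}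
    (hμ : ∑ i ∈ s, p i = μ) (hσ : ∑ i ∈ s, p i ^ 2 = σ) (hμσ : 2 * σ + 4 ≤ μ) :
    (M : ℝ) ∈ Set.Icc (μ - 1 - σ * (8 * σ + 6) / (μ - 2 * σ - 2))
      (μ + σ * (8 * σ + 6) / (μ - 2 * σ - 2)) := by
  have hσ0 : 0 ≤ σ := hσ ▸ Finset.sum_nonneg fun i _ => sq_nonneg _
  have hQ : 0 < (bernoulliSumPGF p s).coeff M := (coeff_zero_pos h1 s).trans_le (hM 0)
  have hM0 : M ≠ 0 := by
    rintro rfl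
    have h := succ_mul_coeff_succ (p := p) (s := s) 0
    have h2 : μ * (bernoulliSumPGF p s).coeff 0 ≤
        ∑ i ∈ s, p i * (bernoulliSumPGF p (s.erase i)).coeff 0 := by
      rw [← hμ, Finset.sum_mul]
      refine Finset.sum_le_sum fun i hi => mul_le_mul_of_nonneg_left ?_ (h0 i)
      rw [coeff_zero_eq hi]
      nlinarith [coeff_nonneg h0 h1 (s.erase i) 0, h0 i]
    rw [← h] at h2
    push_cast at h2
    nlinarith [hM 1]
  set Q := (bernoulliSumPGF p s).coeff M
  -- Crude localisation, completed by `hup`: the identity just after, then just before, the mode.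
  have hlow : μ - 2 * σ - 1 ≤ M := by
    obtain ⟨n, rfl⟩ := Nat.exists_eq_succ_of_ne_zero hM0
    have h := (abs_le.1 (abs_stein_le_of_le h0 h1 hM n)).1
    rw [hμ, hσ] at h
    have h3 := hM (n + 2)
    have h4 : ((n : ℝ) + 2) * (bernoulliSumPGF p s).coeff (n + 2) ≤ ((n : ℝ) + 2) * Q :=
      mul_le_mul_of_nonneg_left h3 (by positivity)
    change -(σ * (2 * Q)) ≤ ((n : ℝ) + 2) * (bernoulliSumPGF p s).coeff (n + 2) - μ * Q at h
    have h5 : (μ - 2 * σ) * Q ≤ ((n : ℝ) + 2) * Q := by linarith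
    have h6 := le_of_mul_le_mul_right h5 hQ
    push_cast
    linarith
  have hM3 : 3 ≤ M := by
    have : (3 : ℝ) ≤ M := by linarith
    exact_mod_cast this
  obtain ⟨n, rfl⟩ := Nat.exists_eq_add_of_le' hM3
  push_cast at hlow ⊢
  have hμ0 : 0 ≤ μ := by linarith
  have hup : (n : ℝ) + 3 ≤ μ + 2 * σ := by
    have h := (abs_le.1 (abs_stein_le_of_le h0 h1 hM (n + 1))).2
    rw [hμ, hσ] at h
    push_cast at h
    change ((n : ℝ) + 1 + 2) * Q - μ * (bernoulliSumPGF p s).coeff (n + 2) ≤ σ * (2 * Q) at h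
    have h4 := mul_le_mul_of_nonneg_left (hM (n + 2)) hμ0
    have h5 : ((n : ℝ) + 3) * Q ≤ (μ + 2 * σ) * Q := by linarith
    exact le_of_mul_le_mul_right h5 hQ
  have hpos : 0 < μ - 2 * σ - 2 := by linarith
  set E := (8 * σ + 6) / (μ - 2 * σ - 2) with hE
  have hEQ : σ * (8 * σ + 6) / (μ - 2 * σ - 2) = σ * E := by rw [hE, mul_div_assoc]
  -- This range contains `m + 2 = M - 1` and `m + 2 = M`, the two cases used below.
  have hdiff : ∀ m : ℕ, μ - 2 * σ - 2 ≤ (m : ℝ) + 2 → (m : ℝ) + 2 ≤ μ + 2 * σ → ∀ i ∈ s,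
      |(bernoulliSumPGF p (s.erase i)).coeff (m + 2) -
        (bernoulliSumPGF p (s.erase i)).coeff (m + 1)| ≤ E * Q := by
    intro m hm1 hm2 i hi
    have h := mul_abs_coeff_erase_sub_le h0 h1 hM hi m
    rw [hμ, hσ] at h
    have ha : |μ - (m + 2)| ≤ 2 * σ + 2 := by
      rw [abs_le]; constructor <;> linarith
    have hb := mul_le_mul_of_nonneg_right hm1 (abs_nonneg
      ((bernoulliSumPGF p (s.erase i)).coeff (m + 2) -
        (bernoulliSumPGF p (s.erase i)).coeff (m + 1)))
    have hc : (2 * (|μ - (m + 2)| + 1) + 4 * σ) * Q ≤ (8 * σ + 6) * Q :=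
      mul_le_mul_of_nonneg_right (by linarith) hQ.le
    rw [hE, div_mul_eq_mul_div, le_div_iff₀ hpos, mul_comm]
    linarith
  rw [hEQ]
  constructor
  · have h := (abs_le.1 (abs_stein_le (n + 2) (hdiff (n + 1) (by push_cast; linarith)
      (by push_cast; linarith)))).1
    rw [hμ, hσ] at h
    push_cast at h
    change -(σ * (E * Q)) ≤ ((n : ℝ) + 2 + 2) * (bernoulliSumPGF p s).coeff (n + 4) - μ * Q at h
    have h4 : ((n : ℝ) + 2 + 2) * (bernoulliSumPGF p s).coeff (n + 4) ≤ ((n : ℝ) + 2 + 2) * Q :=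
      mul_le_mul_of_nonneg_left (hM (n + 4)) (by positivity)
    have h5 : (μ - σ * E) * Q ≤ ((n : ℝ) + 4) * Q := by linarith
    linarith [le_of_mul_le_mul_right h5 hQ]
  · have h := (abs_le.1 (abs_stein_le (n + 1) (hdiff n (by linarith) (by linarith)))).2
    rw [hμ, hσ] at h
    push_cast at h
    change ((n : ℝ) + 1 + 2) * Q - μ * (bernoulliSumPGF p s).coeff (n + 2) ≤ σ * (E * Q) at h
    have h4 := mul_le_mul_of_nonneg_left (hM (n + 2)) hμ0
    have h5 : ((n : ℝ) + 3) * Q ≤ (μ + σ * E) * Q := by linarith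
    exact le_of_mul_le_mul_right h5 hQ

end bernoulliSumPGF

/-! ### Harmonic numbers to second order. -/

/-- The error of the trapezoidal rule for `1 / t` on `[1, 1 + x]`. -/
theorem trapezoid_sub_log_one_add_mem_Icc {x : ℝ} (hx : 0 ≤ x) :
    (x + x / (1 + x)) / 2 - Real.log (1 + x) ∈ Set.Icc 0 (x ^ 3 / 6) := by
  have hd : ∀ y ∈ interior (Set.Ici (0 : ℝ)),
      HasDerivAt (fun x : ℝ => (x + x / (1 + x)) / 2 - Real.log (1 + x))
        (y ^ 2 / (2 * (1 + y) ^ 2)) y := by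
    intro y hy
    rw [interior_Ici, Set.mem_Ioi] at hy
    have hy1 : 1 + y ≠ 0 := by positivity
    have h1 : HasDerivAt (fun x : ℝ => 1 + x) 1 y := (hasDerivAt_id y).const_add 1
    refine ((((hasDerivAt_id y).add ((hasDerivAt_id y).div h1 hy1)).div_const 2).sub
      (h1.log hy1)).congr_deriv ?_
    simp only [id]
    field_simp
    ring
  have hc : ContinuousOn (fun x : ℝ => (x + x / (1 + x)) / 2 - Real.log (1 + x)) (Set.Ici 0) := by
    have hne : ∀ x ∈ Set.Ici (0 : ℝ), 1 + x ≠ 0 := fun x hx => by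
      have : (0 : ℝ) ≤ x := hx
      positivity
    have h1 : ContinuousOn (fun x : ℝ => 1 + x) (Set.Ici 0) := by fun_prop
    exact ((continuousOn_id.add (continuousOn_id.div h1 hne)).div_const 2).sub (h1.log hne)
  constructor
  · have hm := monotoneOn_of_deriv_nonneg (convex_Ici 0) hc
      (fun y hy => (hd y hy).differentiableAt.differentiableWithinAt)
      (fun y hy => by rw [(hd y hy).deriv]; positivity)
    simpa using hm Set.self_mem_Ici hx hx
  · have hd' : ∀ y ∈ interior (Set.Ici (0 : ℝ)),
        HasDerivAt (fun x : ℝ => x ^ 3 / 6 - ((x + x / (1 + x)) / 2 - Real.log (1 + x)))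
          (y ^ 2 / 2 - y ^ 2 / (2 * (1 + y) ^ 2)) y := by
      intro y hy
      refine (((hasDerivAt_pow 3 y).div_const 6).sub (hd y hy)).congr_deriv ?_
      norm_num
      ring
    have hm := monotoneOn_of_deriv_nonneg (convex_Ici 0)
      (((continuous_pow 3).div_const (6 : ℝ)).continuousOn.sub hc)
      (fun y hy => (hd' y hy).differentiableAt.differentiableWithinAt)
      (fun y hy => by
        refine le_of_le_of_eq ?_ (hd' y hy).deriv.symm
        rw [interior_Ici, Set.mem_Ioi] at hy
        rw [sub_nonneg]
        refine div_le_div_of_nonneg_left (by positivity) (by norm_num) ?_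
        nlinarith)
    have := hm Set.self_mem_Ici hx hx
    simp at this
    linarith

/-- `H_n = log n + γ + 1 / (2 n) + O(1 / n ^ 2)`. -/
theorem harmonic_sub_log_mem_Icc {n : ℕ} (hn : 1 ≤ n) :
    (harmonic n : ℝ) - Real.log n - Real.eulerMascheroniConstant - 1 / (2 * n) ∈
      Set.Icc (-(1 / (n : ℝ) ^ 2)) 0 := by
  -- The increments are trapezoidal errors, so the sequence increases to γ, and adding `1 / m ^ 2`
  -- makes it decrease to γ.
  have step : ∀ m : ℕ, 1 ≤ m →
      ((harmonic (m + 1) : ℝ) - Real.log ((m + 1 : ℕ) : ℝ) - 1 / (2 * ((m + 1 : ℕ) : ℝ))) -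
        ((harmonic m : ℝ) - Real.log m - 1 / (2 * m)) ∈ Set.Icc 0 (1 / (6 * (m : ℝ) ^ 3)) := by
    intro m hm
    have hm0 : (0 : ℝ) < m := by exact_mod_cast hm
    have h := trapezoid_sub_log_one_add_mem_Icc (x := 1 / (m : ℝ)) (by positivity)
    have hl : Real.log (1 + 1 / (m : ℝ)) = Real.log ((m : ℝ) + 1) - Real.log m := by
      rw [← Real.log_div (by positivity) (by positivity)]
      congr 1
      field_simp
    have e1 : (1 / (m : ℝ)) ^ 3 / 6 = 1 / (6 * (m : ℝ) ^ 3) := by field_simp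
    have e2 : ((harmonic (m + 1) : ℝ) - Real.log ((m + 1 : ℕ) : ℝ) -
        1 / (2 * ((m + 1 : ℕ) : ℝ))) - ((harmonic m : ℝ) - Real.log m - 1 / (2 * m)) =
        (1 / (m : ℝ) + 1 / (m : ℝ) / (1 + 1 / (m : ℝ))) / 2 - Real.log (1 + 1 / (m : ℝ)) := by
      rw [hl, harmonic_succ]
      push_cast
      field_simp
      ring
    rw [e2, ← e1]
    exact h
  have lim : Filter.Tendsto (fun m : ℕ => (harmonic m : ℝ) - Real.log m - 1 / (2 * m))
      Filter.atTop (nhds Real.eulerMascheroniConstant) := by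
    have h2 : Filter.Tendsto (fun m : ℕ => (1 / 2 : ℝ) * (1 / (m : ℝ))) Filter.atTop
        (nhds ((1 / 2) * 0)) := tendsto_one_div_atTop_nhds_zero_nat.const_mul _
    have h3 := Real.tendsto_harmonic_sub_log.sub h2
    rw [mul_zero, sub_zero] at h3
    refine h3.congr fun m => ?_
    ring
  have lim2 : Filter.Tendsto
      (fun m : ℕ => (harmonic m : ℝ) - Real.log m - 1 / (2 * m) + 1 / (m : ℝ) ^ 2)
      Filter.atTop (nhds Real.eulerMascheroniConstant) := by
    have h2 : Filter.Tendsto (fun m : ℕ => (1 / (m : ℝ)) ^ 2) Filter.atTop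
        (nhds (0 ^ 2)) := tendsto_one_div_atTop_nhds_zero_nat.pow 2
    have h3 := lim.add h2
    rw [zero_pow two_ne_zero, add_zero] at h3
    refine h3.congr fun m => ?_
    rw [div_pow, one_pow]
  constructor
  · suffices Real.eulerMascheroniConstant ≤
        (harmonic n : ℝ) - Real.log n - 1 / (2 * n) + 1 / (n : ℝ) ^ 2 by linarith
    refine le_of_tendsto lim2 (Filter.eventually_atTop.2 ⟨n, fun m hm => ?_⟩)
    induction m, hm using Nat.le_induction with
    | base => exact le_rfl
    | succ m hm ih =>
      refine le_trans ?_ ih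
      have h := (step m (hn.trans hm)).2
      have hm0 : (1 : ℝ) ≤ m := by exact_mod_cast hn.trans hm
      have h2 : 1 / (6 * (m : ℝ) ^ 3) ≤ 1 / (m : ℝ) ^ 2 - 1 / ((m + 1 : ℕ) : ℝ) ^ 2 := by
        push_cast
        rw [div_sub_div _ _ (by positivity) (by positivity), div_le_div_iff₀ (by positivity)
          (by positivity)]
        have : 0 ≤ (m : ℝ) ^ 2 * (11 * m ^ 2 + 4 * m - 1) := by
          have : 0 ≤ 11 * (m : ℝ) ^ 2 + 4 * m - 1 := by nlinarith
          positivity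
        nlinarith
      linarith
  · suffices (harmonic n : ℝ) - Real.log n - 1 / (2 * n) ≤ Real.eulerMascheroniConstant by linarith
    refine ge_of_tendsto lim (Filter.eventually_atTop.2 ⟨n, fun m hm => ?_⟩)
    induction m, hm using Nat.le_induction with
    | base => exact le_rfl
    | succ m hm ih => linarith [(step m (hn.trans hm)).1]

/-! ### The Bernoulli parameters of the moment polynomial. -/

namespace KeatingSnaith

theorem mu_eq (k : ℕ) :
    mu k = (2 * (k : ℝ) + 1) * ((harmonic (2 * k) : ℝ) - harmonic k) - harmonic k := by
  have h1 : ∀ n : ℕ, ∑ j ∈ Finset.Icc 1 n, (j : ℝ) / ((j : ℝ) + 1) =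
      n + 1 - (harmonic (n + 1) : ℝ) := by
    intro n
    induction n with
    | zero => simp [harmonic_succ]
    | succ n ih =>
      rw [Finset.sum_Icc_succ_top (by omega), ih, harmonic_succ (n + 1)]
      push_cast
      field_simp
      ring
  have h2 : ∀ n : ℕ, ∑ j ∈ Finset.Icc (k + 1) (k + n), (2 * (k : ℝ) - (j : ℝ)) / ((j : ℝ) + 1) =
      (2 * (k : ℝ) + 1) * ((harmonic (k + n + 1) : ℝ) - harmonic (k + 1)) - n := by
    intro n
    induction n with
    | zero => simp
    | succ n ih =>
      rw [← add_assoc, Finset.sum_Icc_succ_top (by omega), ih, harmonic_succ (k + n + 1)]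
      push_cast
      field_simp
      ring
  rw [mu, h1, show 2 * k = k + k by ring, h2, harmonic_succ (k + k), harmonic_succ k]
  push_cast
  field_simp
  ring

/-- The antidiagonal $i+j+1=n$ of the square has $n$ points for $n\le k$ and $2k-n$ beyond. The
induction instead adds a last row and column. -/
theorem sum_one_div_add_two_eq_mu (k : ℕ) :
    ∑ x ∈ Finset.range k ×ˢ Finset.range k, 1 / ((x.1 : ℝ) + x.2 + 2) = mu k := by
  rw [Finset.sum_product' (f := fun i j : ℕ => 1 / ((i : ℝ) + j + 2)), mu_eq]
  have hrow : ∀ k n : ℕ, ∑ j ∈ Finset.range n, 1 / ((k : ℝ) + j + 2) =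
      (harmonic (k + n + 1) : ℝ) - harmonic (k + 1) := by
    intro k n
    induction n with
    | zero => simp
    | succ n ih =>
      rw [Finset.sum_range_succ, ih, ← add_assoc, harmonic_succ (k + n + 1)]
      push_cast
      ring
  induction k with
  | zero => simp
  | succ k ih =>
    rw [Finset.sum_range_succ]
    simp only [Finset.sum_range_succ _ k]
    rw [Finset.sum_add_distrib, ih, hrow]
    have hcol : ∑ i ∈ Finset.range k, 1 / ((i : ℝ) + k + 2) =
        (harmonic (k + k + 1) : ℝ) - harmonic (k + 1) := by
      rw [← hrow]
      exact Finset.sum_congr rfl fun i _ => by rw [add_comm (i : ℝ)]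
    rw [hcol, show 2 * (k + 1) = k + k + 1 + 1 by ring, show 2 * k = k + k by ring,
      harmonic_succ (k + k + 1), harmonic_succ (k + k), harmonic_succ k]
    push_cast
    field_simp
    ring

/-- Row `i` is at most `1 / (i + 1)` by telescoping. -/
theorem sum_one_div_add_two_sq_le (k : ℕ) :
    ∑ x ∈ Finset.range k ×ˢ Finset.range k, (1 / ((x.1 : ℝ) + x.2 + 2)) ^ 2 ≤
      (harmonic k : ℝ) := by
  rw [Finset.sum_product' (f := fun i j : ℕ => (1 / ((i : ℝ) + j + 2)) ^ 2)]
  have hrow : ∀ i n : ℕ, ∑ j ∈ Finset.range n, (1 / ((i : ℝ) + j + 2)) ^ 2 ≤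
      1 / ((i : ℝ) + 1) - 1 / ((i : ℝ) + n + 1) := by
    intro i n
    induction n with
    | zero => simp
    | succ n ih =>
      rw [Finset.sum_range_succ]
      have h : (1 / ((i : ℝ) + n + 2)) ^ 2 ≤
          1 / ((i : ℝ) + n + 1) - 1 / ((i : ℝ) + (n + 1 : ℕ) + 1) := by
        push_cast
        rw [div_sub_div _ _ (by positivity) (by positivity), div_pow, div_le_div_iff₀
          (by positivity) (by positivity)]
        nlinarith [(by positivity : (0 : ℝ) ≤ (i : ℝ) + n + 2)]
      linarith
  rw [harmonic]
  push_cast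
  refine Finset.sum_le_sum fun i _ => (hrow i k).trans ?_
  rw [one_div]
  have : (0 : ℝ) ≤ 1 / ((i : ℝ) + k + 1) := by positivity
  linarith

open Polynomial in
theorem exists_momentPoly_eq (k : ℕ) : ∃ A : ℝ, 0 < A ∧ momentPoly k =
    C A * bernoulliSumPGF (fun x : ℕ × ℕ => 1 / ((x.1 : ℝ) + x.2 + 2))
      (Finset.range k ×ˢ Finset.range k) := by
  refine ⟨∏ x ∈ Finset.range k ×ˢ Finset.range k, ((x.1 : ℝ) + x.2 + 2) / ((x.1 : ℝ) + x.2 + 1),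
    Finset.prod_pos fun x _ => by positivity, ?_⟩
  rw [momentPoly, ← Finset.prod_product' (f := fun i j : ℕ =>
    (1 + C (1 / ((i : ℝ) + (j : ℝ) + 1)) * X)), bernoulliSumPGF, map_prod,
    ← Finset.prod_mul_distrib]
  refine Finset.prod_congr rfl fun x _ => ?_
  rw [mul_add, ← mul_assoc, ← C_mul, ← C_mul, ← C_1]
  congr 3
  · field_simp
    ring
  · field_simp

theorem natDegree_momentPoly_le (k : ℕ) : (momentPoly k).natDegree ≤ k ^ 2 := by
  refine (Polynomial.natDegree_prod_le _ _).trans ?_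
  have h : ∀ i ∈ Finset.range k, (∏ j ∈ Finset.range k, (1 + Polynomial.C
      (1 / ((i : ℝ) + (j : ℝ) + 1)) * Polynomial.X)).natDegree ≤ k := by
    intro i _
    refine (Polynomial.natDegree_prod_le _ _).trans ?_
    refine (Finset.sum_le_card_nsmul _ _ 1 fun j _ => ?_).trans (by simp)
    compute_degree
  exact (Finset.sum_le_card_nsmul _ _ k h).trans (by simp [sq])

theorem isMaximalIndex_iff {k r : ℕ} (hr : r ≤ k ^ 2) :
    IsMaximalIndex k r ↔ ∀ m, (momentPoly k).coeff m ≤ (momentPoly k).coeff (k ^ 2 - r) := by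
  refine ⟨fun h m => ?_, fun h => ⟨hr, fun s _ => h _⟩⟩
  rcases le_or_gt m (k ^ 2) with hm | hm
  · have := h.2 (k ^ 2 - m) (Nat.sub_le _ _)
    rwa [momentCoeff, momentCoeff, Nat.sub_sub_self hm] at this
  · rw [Polynomial.coeff_eq_zero_of_natDegree_lt ((natDegree_momentPoly_le k).trans_lt hm)]
    obtain ⟨A, hA, hP⟩ := exists_momentPoly_eq k
    rw [hP, Polynomial.coeff_C_mul]
    refine mul_nonneg hA.le (bernoulliSumPGF.coeff_nonneg (fun x => by positivity) (fun x => ?_) _ _)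
    exact one_div_le_one_div_of_le (by norm_num) (le_add_of_nonneg_left (by positivity))

theorem exists_isMaximalIndex (k : ℕ) : ∃ r, IsMaximalIndex k r := by
  obtain ⟨r, hr, h⟩ := Finset.exists_max_image (Finset.range (k ^ 2 + 1))
    (fun r => momentCoeff r k) ⟨0, by simp⟩
  exact ⟨r, by simpa [Nat.lt_succ_iff] using hr, fun s hs =>
    h s (by simpa [Nat.lt_succ_iff] using hs)⟩

theorem IsMaximalIndex.mem_Icc {k r : ℕ} (h : IsMaximalIndex k r) {σ : ℝ}
    (hσ : ∑ x ∈ Finset.range k ×ˢ Finset.range k, (1 / ((x.1 : ℝ) + x.2 + 2)) ^ 2 = σ)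
    (hμ : 2 * σ + 4 ≤ mu k) :
    (r : ℝ) ∈ Set.Icc ((k : ℝ) ^ 2 - mu k - σ * (8 * σ + 6) / (mu k - 2 * σ - 2))
      ((k : ℝ) ^ 2 - mu k + 1 + σ * (8 * σ + 6) / (mu k - 2 * σ - 2)) := by
  obtain ⟨A, hA, hP⟩ := exists_momentPoly_eq k
  have hmax := (isMaximalIndex_iff h.1).1 h
  simp only [hP, Polynomial.coeff_C_mul] at hmax
  have hM := bernoulliSumPGF.mode_mem_Icc (fun x => by positivity)
    (fun x => one_div_le_one_div_of_le (by norm_num) (le_add_of_nonneg_left (by positivity)))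
    (fun m => le_of_mul_le_mul_left (hmax m) hA) (sum_one_div_add_two_eq_mu k) hσ hμ
  rw [Nat.cast_sub h.1, Nat.cast_pow] at hM
  exact ⟨by linarith [hM.2], by linarith [hM.1]⟩

/-- In `mu_eq` harmonic numbers are multiplied by about `2 * k`, hence the need for their expansion
up to `O(1 / n ^ 2)`. -/
theorem abs_mu_sub_le {k : ℕ} (hk : 1 ≤ k) :
    |mu k - ((k : ℝ) * Real.log 4 - Real.log ((k : ℝ) / 2) - 1 / 2 -
      Real.eulerMascheroniConstant)| ≤ 10 * (1 / (k : ℝ)) := by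
  have hk0 : (1 : ℝ) ≤ k := by exact_mod_cast hk
  have hk1 : (0 : ℝ) < k := by linarith
  have h1 := harmonic_sub_log_mem_Icc hk
  have h2 := harmonic_sub_log_mem_Icc (n := 2 * k) (by omega)
  push_cast at h2
  rw [Real.log_mul two_ne_zero hk1.ne'] at h2
  have l4 : Real.log 4 = 2 * Real.log 2 := by
    rw [show (4 : ℝ) = 2 ^ 2 by norm_num, Real.log_pow]; norm_num
  rw [mu_eq, Real.log_div hk1.ne' two_ne_zero, l4]
  set a := (harmonic k : ℝ) - Real.log k - Real.eulerMascheroniConstant - 1 / (2 * k) with ha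
  set b := (harmonic (2 * k) : ℝ) - (Real.log 2 + Real.log k) - Real.eulerMascheroniConstant -
    1 / (2 * (2 * k)) with hb
  have e : (2 * (k : ℝ) + 1) * ((harmonic (2 * k) : ℝ) - harmonic k) - harmonic k -
      (k * (2 * Real.log 2) - (Real.log k - Real.log 2) - 1 / 2 - Real.eulerMascheroniConstant) =
      (2 * (k : ℝ) + 1) * b - (2 * k + 2) * a - 3 / 4 * (1 / k) := by
    rw [ha, hb]
    field_simp
    ring
  rw [e]
  have hak : -(1 / (k : ℝ)) ≤ k * a := by
    have := mul_le_mul_of_nonneg_left h1.1 hk1.le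
    refine le_of_eq_of_le ?_ this
    field_simp
  have hbk : -(1 / (k : ℝ)) ≤ 4 * (k * b) := by
    have := mul_le_mul_of_nonneg_left h2.1 hk1.le
    have e : (k : ℝ) * -(1 / (2 * k) ^ 2) = -(1 / (k : ℝ)) / 4 := by
      field_simp
      norm_num
    linarith
  have ha0 := h1.2
  have hb0 := h2.2
  have ha1 : k * a ≤ a := by nlinarith
  have hb1 : k * b ≤ b := by nlinarith
  have hkinv : 0 < 1 / (k : ℝ) := by positivity
  rw [abs_le]
  constructor <;> linarith

/-- As `log 4 > 1`, `mu k` outgrows `k / 2`; `4 * log k` will dominate `2 * σ`. -/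
theorem eventually_le_mu_sub : ∀ᶠ k : ℕ in Filter.atTop,
    1 ≤ Real.log k ∧ (k : ℝ) / 2 + 4 ≤ mu k - 4 * Real.log k - 2 := by
  have hlog : ∀ᶠ k : ℕ in Filter.atTop, 1 ≤ Real.log (k : ℝ) :=
    (Real.tendsto_log_atTop.comp tendsto_natCast_atTop_atTop).eventually_ge_atTop 1
  have hlo : ∀ᶠ k : ℕ in Filter.atTop, ‖Real.log (k : ℝ)‖ ≤ 1 / 20 * ‖(k : ℝ)‖ :=
    (Real.isLittleO_log_id_atTop.comp_tendsto tendsto_natCast_atTop_atTop).bound (by norm_num)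
  filter_upwards [hlog, hlo, Filter.eventually_ge_atTop 100] with k h1 h2 h3
  refine ⟨h1, ?_⟩
  have hk : (100 : ℝ) ≤ k := by exact_mod_cast h3
  rw [Real.norm_of_nonneg (by linarith), Real.norm_of_nonneg (by linarith)] at h2
  have h4 := (abs_le.1 (abs_mu_sub_le (k := k) (by omega))).1
  have h5 : 1 / (k : ℝ) ≤ 1 := by rw [div_le_one (by linarith)]; linarith
  have l4 : Real.log 4 = 2 * Real.log 2 := by
    rw [show (4 : ℝ) = 2 ^ 2 by norm_num, Real.log_pow]; norm_num
  rw [Real.log_div (by linarith) two_ne_zero, l4] at h4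
  nlinarith [Real.log_two_gt_d9, Real.eulerMascheroniConstant_lt_two_thirds]

end KeatingSnaith

theorem theorem2 :
    (fun k : ℕ => KeatingSnaith.mu k -
        ((k : ℝ) * Real.log 4 - Real.log ((k : ℝ) / 2) - 1 / 2 - Real.eulerMascheroniConstant))
      =O[Filter.atTop] (fun k : ℕ => 1 / (k : ℝ)) ∧
    ∃ ρ : ℝ, 0 < ρ ∧ ∃ K : ℕ, ∀ k : ℕ, K ≤ k →
      (∃ r : ℕ, KeatingSnaith.IsMaximalIndex k r ∧
        (r : ℝ) ∈ Set.Icc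
          ((k : ℝ) ^ 2 - KeatingSnaith.mu k - ρ * Real.log (k : ℝ) ^ 2 / (k : ℝ))
          ((k : ℝ) ^ 2 - KeatingSnaith.mu k + 1 + ρ * Real.log (k : ℝ) ^ 2 / (k : ℝ))) ∧
      (∀ r : ℕ, KeatingSnaith.IsMaximalIndex k r →
        (r : ℝ) ∈ Set.Icc
          ((k : ℝ) ^ 2 - KeatingSnaith.mu k - ρ * Real.log (k : ℝ) ^ 2 / (k : ℝ))
          ((k : ℝ) ^ 2 - KeatingSnaith.mu k + 1 + ρ * Real.log (k : ℝ) ^ 2 / (k : ℝ))) := by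
  constructor
  · refine Asymptotics.IsBigO.of_bound 10 (Filter.eventually_atTop.2 ⟨1, fun k hk => ?_⟩)
    rw [Real.norm_eq_abs, Real.norm_of_nonneg (by positivity : (0 : ℝ) ≤ 1 / (k : ℝ))]
    exact KeatingSnaith.abs_mu_sub_le hk
  · obtain ⟨K, hK⟩ := Filter.eventually_atTop.1 KeatingSnaith.eventually_le_mu_sub
    -- With `L = log k ≥ 1`: `σ ≤ 2L` and `8σ + 6 ≤ 22L`, while the denominator is at least `k / 2`,
    -- giving `2 * 22 * 2 = 88`.
    refine ⟨88, by norm_num, max K 1, fun k hk => ?_⟩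
    obtain ⟨hL, hμ⟩ := hK k ((le_max_left _ _).trans hk)
    have hk0 : (0 : ℝ) < k := by exact_mod_cast (le_max_right K 1).trans hk
    suffices hall : ∀ r : ℕ, KeatingSnaith.IsMaximalIndex k r → (r : ℝ) ∈ Set.Icc
          ((k : ℝ) ^ 2 - KeatingSnaith.mu k - 88 * Real.log (k : ℝ) ^ 2 / (k : ℝ))
          ((k : ℝ) ^ 2 - KeatingSnaith.mu k + 1 + 88 * Real.log (k : ℝ) ^ 2 / (k : ℝ)) by
      obtain ⟨r, hr⟩ := KeatingSnaith.exists_isMaximalIndex k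
      exact ⟨⟨r, hr, hall r hr⟩, hall⟩
    intro r hr
    obtain ⟨σ, hσ⟩ : ∃ σ, ∑ x ∈ Finset.range k ×ˢ Finset.range k,
      (1 / ((x.1 : ℝ) + x.2 + 2)) ^ 2 = σ := ⟨_, rfl⟩
    have hσL : σ ≤ 2 * Real.log k := by
      have h1 := KeatingSnaith.sum_one_div_add_two_sq_le k
      rw [hσ] at h1
      linarith [harmonic_le_one_add_log k]
    have hσ0 : 0 ≤ σ := hσ ▸ Finset.sum_nonneg fun x _ => sq_nonneg _
    have hr' := hr.mem_Icc hσ (by linarith)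
    have hE : σ * (8 * σ + 6) / (KeatingSnaith.mu k - 2 * σ - 2) ≤
        88 * Real.log (k : ℝ) ^ 2 / (k : ℝ) := by
      have hden : (k : ℝ) / 2 ≤ KeatingSnaith.mu k - 2 * σ - 2 := by linarith
      have hnum : σ * (8 * σ + 6) ≤ 44 * Real.log (k : ℝ) ^ 2 := by
        calc σ * (8 * σ + 6) ≤ (2 * Real.log k) * (22 * Real.log k) :=
              mul_le_mul hσL (by linarith) (by linarith) (by linarith)
          _ = _ := by ring
      refine (div_le_div₀ (by positivity) hnum (by positivity) hden).trans_eq ?_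
      field_simp
      norm_num
    exact ⟨by linarith [hr'.1], by linarith [hr'.2]⟩
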